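/- Let $\dot W$ be a Gaussian white noise on $\mathbb R$ over a probability space $(\Omega,\mathcal F,\mathbb P)$, i.e. the Wiener integrals $W(f)=\int_{\mathbb R} f\,dW$, $f\in L^2(\mathbb R)$, form a centred Gaussian family with $\mathbb E[W(f)W(g)]=\int_{\mathbb R} fg$. Let $\theta>0$, $\sigma\in\mathbb R$, and let $u$ be the mild solution of $\partial_t u=\theta\,\partial_{xx}u+\sigma\dot W(x)$, $t>0$, $x\in\mathbb R$, $u(0,\cdot)=0$: for every $t>0$ and $x\in\mathbb R$, almost surely, $$u(t,x)=\sigma\int_0^t\int_{\mathbb R}P(t-s,x-y)\,dW(y)\,ds,\qquad P(t,z)=\frac{1}{\sqrt{4\pi\theta t}}\,e^{-z^2/(4\theta t)},$$ the $ds$-integral being a Bochner integral in $L^2(\Omega)$. Let $A<B$, $a,b\in[0,1]$ with $a+b>0$, $\gamma\ge 1$, $M\ge 1$ and $0<t_1<\dots<t_M$ be fixed. For $N\ge1$ put $x_i=A+(B-A)i/N$, $h_N=(B-A)/N^{\gamma}$, $\Delta_h u(t,x)=\dfrac{u(t,x+ah)-u(t,x-bh)}{(a+b)h}$, and $$S_{N,M}=\sum_{j=1}^M\sum_{i=2}^{N-1}\bigl(\Delta_{h_N}u(t_j,x_i)-\Delta_{h_N}u(t_j,x_{i-1})\bigr)^2,\qquad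 \widetilde\theta^2_{N,M}=\frac{\sigma^2M(B-A)}{S_{N,M}},\qquad \widetilde\sigma^2_{N,M}=\frac{\theta^2S_{N,M}}{M(B-A)},$$ and let $$\mu=\begin{cases}\dfrac1{a+b}-\dfrac1{3(a+b)^2}, & \gamma=1,\ a+b\ge1,\\[1ex] 1-\dfrac{a+b}{3}, & \gamma=1,\ a+b<1,\\[1ex] 1, & \gamma>1.\end{cases}$$ Then, as $N\to\infty$, $\frac1\mu\,\widetilde\sigma^2_{N,M}\to\sigma^2$ in probability and, if $\sigma\neq0$, $\mu\,\widetilde\theta^2_{N,M}\to\theta^2$ in probability. -/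

import Mathlib

open MeasureTheory ProbabilityTheory Filter

noncomputable section

namespace SpaceNoiseHeat

/-- The heat kernel `P(t, z) = (4 π θ t)^(-1/2) exp(-z² / (4 θ t))` of `∂ₜ - θ ∂ₓₓ` on the line
(for `θ t ≤ 0` the formula evaluates to `0`). -/
def heatKernel (θ t z : ℝ) : ℝ :=
  (√(4 * Real.pi * θ * t))⁻¹ * Real.exp (-z ^ 2 / (4 * θ * t))

/-- `y ↦ P(t, x - y)` is square integrable. -/
theorem memLp_heatKernel (θ t x : ℝ) :
    MemLp (fun y => heatKernel θ t (x - y)) 2 (volume : Measure ℝ) := by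
  rcases le_or_gt (θ * t) 0 with h | h
  · have h0 : √(4 * Real.pi * θ * t) = 0 := by
      apply Real.sqrt_eq_zero_of_nonpos
      have := Real.pi_pos
      nlinarith
    have : (fun y => heatKernel θ t (x - y)) = fun _ => 0 := by
      funext y
      simp only [heatKernel, h0, inv_zero, zero_mul]
    rw [this]
    exact MemLp.zero'
  · have hmeas : AEStronglyMeasurable (fun y => heatKernel θ t (x - y)) volume := by
      apply Continuous.aestronglyMeasurable
      unfold heatKernel
      fun_prop
    rw [memLp_two_iff_integrable_sq hmeas]
    have hb : 0 < 2 / (4 * θ * t) := by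
      apply div_pos two_pos
      nlinarith
    have hi : Integrable
        (fun z : ℝ => ((√(4 * Real.pi * θ * t))⁻¹) ^ 2 *
          Real.exp (-(2 / (4 * θ * t)) * z ^ 2)) volume :=
      (integrable_exp_neg_mul_sq hb).const_mul _
    refine (hi.comp_sub_left x).congr (Eventually.of_forall fun y => ?_)
    simp only [heatKernel, mul_pow, ← Real.exp_nat_mul]
    congr 2
    push_cast
    ring

/-- `y ↦ P(t, x - y)` as an element of `L²(ℝ)`. -/
def heatKernelL2 (θ t x : ℝ) : Lp ℝ 2 (volume : Measure ℝ) :=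
  (memLp_heatKernel θ t x).toLp _

variable {Ω : Type*} [MeasurableSpace Ω]

/-- `W` is a Gaussian white noise on `ℝ`: a centred Gaussian family `W(f)`, `f ∈ L²(ℝ)`, with
`E[W(f) W(g)] = ∫ f g`. The variable `W(f)` is the Wiener integral `∫ f(y) dW(y)`. -/
structure IsWhiteNoise (W : Lp ℝ 2 (volume : Measure ℝ) → Ω → ℝ) (P : Measure Ω) : Prop where
  gaussian : IsGaussianProcess W P
  mean_zero : ∀ f, ∫ ω, W f ω ∂P = 0
  covariance : ∀ f g, ∫ ω, W f ω * W g ω ∂P = inner ℝ f g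

variable {W : Lp ℝ 2 (volume : Measure ℝ) → Ω → ℝ} {P : Measure Ω}

theorem IsWhiteNoise.memLp (hW : IsWhiteNoise W P) (f : Lp ℝ 2 (volume : Measure ℝ)) :
    MemLp (W f) 2 P :=
  (hW.gaussian.hasGaussianLaw_eval f).memLp_two

/-- The Wiener integral `∫ f(y) dW(y)` as an element of `L²(Ω)`. -/
def IsWhiteNoise.wienerIntegral (hW : IsWhiteNoise W P) (f : Lp ℝ 2 (volume : Measure ℝ)) :
    Lp ℝ 2 P :=
  (hW.memLp f).toLp _

/-- The random field `u` is the mild solution of `∂ₜ u = θ ∂ₓₓ u + σ Ẇ(x)`, `u(0, ·) = 0`, on the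
line: for all `t > 0` and all `x`, almost surely,
`u(t, x) = σ ∫₀ᵗ (∫ P(t - s, x - y) dW(y)) ds`.
Wiener integrals are random variables up to null sets, and the `ds`-integral is the Bochner
integral in `L²(Ω)`. Its integrand is continuous on `[0, t)` and of norm `O((t - s)^(-1/4))`. -/
def IsMildSolution (θ σ : ℝ) (hW : IsWhiteNoise W P) (u : ℝ → ℝ → Ω → ℝ) : Prop :=
  ∀ t > 0, ∀ x : ℝ,
    u t x =ᵐ[P] (σ • ∫ s in (0 : ℝ)..t, hW.wienerIntegral (heatKernelL2 θ (t - s) x) : Lp ℝ 2 P)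

/-- The difference quotient `Δ_h f(x) = (f(x + a h) - f(x - b h)) / ((a + b) h)`. -/
def diffQuot (a b h : ℝ) (f : ℝ → ℝ) (x : ℝ) : ℝ :=
  (f (x + a * h) - f (x - b * h)) / ((a + b) * h)

/-- The point `x_i = A + (B - A) i / N` of the uniform partition of `[A, B]`. -/
def gridPoint (A B : ℝ) (N i : ℕ) : ℝ :=
  A + (B - A) * i / N

/-- `∑_{j=1}^M ∑_{i=2}^{N-1} (Δ_h v(t_j, x_i) - Δ_h v(t_j, x_{i-1}))²` with `h = (B - A) / N^γ`. -/
def discreteVariation (A B a b γ : ℝ) {M : ℕ} (t : Fin M → ℝ) (v : ℝ → ℝ → ℝ) (N : ℕ) : ℝ :=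
  ∑ j : Fin M, ∑ i ∈ Finset.Icc 2 (N - 1),
    (diffQuot a b ((B - A) / (N : ℝ) ^ γ) (v (t j)) (gridPoint A B N i)
      - diffQuot a b ((B - A) / (N : ℝ) ^ γ) (v (t j)) (gridPoint A B N (i - 1))) ^ 2

/-- The estimator of `θ²` (for known `σ`) computed from the sampled field `v`. -/
def thetaSqEstimator (σ A B a b γ : ℝ) {M : ℕ} (t : Fin M → ℝ) (v : ℝ → ℝ → ℝ) (N : ℕ) : ℝ :=
  σ ^ 2 * M * (B - A) / discreteVariation A B a b γ t v N

/-- The estimator of `σ²` (for known `θ`) computed from the sampled field `v`. -/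
def sigmaSqEstimator (θ A B a b γ : ℝ) {M : ℕ} (t : Fin M → ℝ) (v : ℝ → ℝ → ℝ) (N : ℕ) : ℝ :=
  θ ^ 2 * discreteVariation A B a b γ t v N / (M * (B - A))

/-- The bias factor `μ` (used for `γ ≥ 1` only, so that the last case is `γ > 1`). -/
def biasFactor (a b γ : ℝ) : ℝ :=
  if γ = 1 then
    if 1 ≤ a + b then 1 / (a + b) - 1 / (3 * (a + b) ^ 2) else 1 - (a + b) / 3
  else 1

end SpaceNoiseHeat

end

namespace SpaceNoiseHeat

/-! The solution is a Wiener integral: `u(t, x) = σ W(G_t(x - ·))` with `G_t = ∫₀ᵗ P(r, ·) dr`.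
Since `|z| / 2` has the Dirac mass as second derivative, running the heat flow from it gives `θ G_t
= smoothAbs √(θ t) - |·| / 2`. The first term is smooth with second derivative `P(t, ·)`; the kink
carries all of the limiting variation.

Each summand of `S_{N,M}` is the square of a mixed difference with steps `p = (B - A) / N` and `q =
(a + b) h_N`, divided by `q`. On the smooth term this difference is `O(p)` in `L²(ℝ)`; on the kink
it is exactly `-θ⁻¹` times a trapezoidal bump of squared norm `p * bumpRatio (q / p)`
(`exists_norm_second_difference_heatPotentialL2_le`). As `q / p = (a + b) N^(1 - γ)`, the ratio
tends to `μ`, so the `N - 2` means at one time add up to `σ² (B - A) μ / θ²` in the limit.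

Because `q ≤ 2 p`, bumps three or more indices apart have disjoint supports; their Wiener integrals
are uncorrelated and jointly Gaussian, hence independent. The sum of squares then has variance `O(N
p²)`, while the smooth term changes it by `O(N p^(3/2))` in `L¹(Ω)`
(`IsWhiteNoise.integral_abs_perturbed_sum_sq_sub_le`). Both vanish, which gives `L¹` convergence at
each time. Summing over the times and applying a continuous map at the limit yields both estimators.
-/

open Topology

/-! ### Gaussian regularisation of the absolute value -/

/-- The primitive `x ↦ ∫₀ˣ exp (-v²) dv`. -/
noncomputable def gaussPrimitive (x : ℝ) : ℝ := ∫ v in (0 : ℝ)..x, Real.exp (-v ^ 2)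

theorem hasDerivAt_gaussPrimitive (x : ℝ) :
    HasDerivAt gaussPrimitive (Real.exp (-x ^ 2)) x := by
  have hc : Continuous fun v : ℝ => Real.exp (-v ^ 2) := by fun_prop
  exact intervalIntegral.integral_hasDerivAt_right (hc.intervalIntegrable _ _)
    (hc.stronglyMeasurableAtFilter _ _) hc.continuousAt

theorem gaussPrimitive_neg (x : ℝ) : gaussPrimitive (-x) = -gaussPrimitive x := by
  unfold gaussPrimitive
  have := intervalIntegral.integral_comp_neg (a := 0) (b := x) (fun v : ℝ => Real.exp (-v ^ 2))
  simp only [neg_sq, neg_zero] at this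
  rw [this, intervalIntegral.integral_symm]

theorem tendsto_gaussPrimitive_atTop :
    Tendsto gaussPrimitive atTop (𝓝 (√Real.pi / 2)) := by
  have h := integral_gaussian_Ioi 1
  simp only [neg_mul, one_mul, div_one] at h
  rw [← h]
  refine intervalIntegral_tendsto_integral_Ioi 0 ?_ tendsto_id
  have := integrable_exp_neg_mul_sq (b := 1) one_pos
  simp only [neg_mul, one_mul] at this
  exact this.integrableOn

/-- The Gaussian regularisation of `|z| / 2` at scale `s`. -/
noncomputable def smoothAbs (s z : ℝ) : ℝ :=
  (z * gaussPrimitive (z / (2 * s)) + s * Real.exp (-(z / (2 * s)) ^ 2)) / √Real.pi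

/-- The contributions from differentiating the argument `z / (2 * s)` in the two terms cancel; only
the explicit factor `s` contributes. -/
theorem hasDerivAt_smoothAbs_scale {s : ℝ} (hs : 0 < s) (z : ℝ) :
    HasDerivAt (fun s => smoothAbs s z) (Real.exp (-(z / (2 * s)) ^ 2) / √Real.pi) s := by
  have h1 : HasDerivAt (fun s : ℝ => z / (2 * s)) (-z / (2 * s ^ 2)) s := by
    have := ((hasDerivAt_id s).const_mul 2).fun_inv (by simpa using hs.ne')
    have := this.const_mul z
    refine this.congr_deriv ?_
    simp only [id]
    field_simp
  have h2 := ((hasDerivAt_gaussPrimitive _).comp s h1).const_mul z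
  have h3 := (hasDerivAt_id s).mul ((h1.pow 2).neg.exp)
  have h4 := (h2.add h3).div_const √Real.pi
  refine h4.congr_deriv ?_
  congr 1
  simp only [Pi.pow_apply, Pi.neg_apply, id, Nat.reduceSub, pow_one,
    Nat.cast_ofNat]
  field_simp
  ring

theorem hasDerivAt_smoothAbs {s : ℝ} (hs : 0 < s) (z : ℝ) :
    HasDerivAt (smoothAbs s) (gaussPrimitive (z / (2 * s)) / √Real.pi) z := by
  have h1 : HasDerivAt (fun z : ℝ => z / (2 * s)) (1 / (2 * s)) z :=
    (hasDerivAt_id z).div_const _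
  have h2 := (hasDerivAt_id z).mul ((hasDerivAt_gaussPrimitive _).comp z h1)
  have h3 := ((h1.pow 2).neg.exp).const_mul s
  have h4 := (h2.add h3).div_const √Real.pi
  refine h4.congr_deriv ?_
  congr 1
  simp only [Function.comp_apply, Pi.pow_apply, Pi.neg_apply, id, Nat.reduceSub, pow_one,
    Nat.cast_ofNat]
  field_simp
  ring

theorem tendsto_smoothAbs_zero (z : ℝ) :
    Tendsto (fun s => smoothAbs s z) (𝓝[>] 0) (𝓝 (|z| / 2)) := by
  have hpi : √Real.pi ≠ 0 := (Real.sqrt_pos.2 Real.pi_pos).ne'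
  -- Both sides are even in `z`, so nonnegative `z` suffice.
  have key : ∀ z : ℝ, 0 ≤ z → Tendsto (fun s => smoothAbs s z) (𝓝[>] 0) (𝓝 (|z| / 2)) := by
    intro z hz
    have h2 : Tendsto (fun s : ℝ => s * Real.exp (-(z / (2 * s)) ^ 2)) (𝓝[>] 0) (𝓝 0) := by
      have h0 : Tendsto (fun s : ℝ => s) (𝓝[>] 0) (𝓝 0) := tendsto_id.mono_left nhdsWithin_le_nhds
      refine squeeze_zero' ?_ ?_ h0
      · filter_upwards [self_mem_nhdsWithin] with s hs
        exact mul_nonneg (le_of_lt hs) (Real.exp_pos _).le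
      · filter_upwards [self_mem_nhdsWithin] with s hs
        have : Real.exp (-(z / (2 * s)) ^ 2) ≤ 1 := Real.exp_le_one_iff.2 (by nlinarith [sq_nonneg (z / (2 * s))])
        have hs' : 0 < s := hs
        nlinarith
    have h1 : Tendsto (fun s : ℝ => z * gaussPrimitive (z / (2 * s))) (𝓝[>] 0)
        (𝓝 (z * (√Real.pi / 2))) := by
      rcases hz.eq_or_lt with rfl | hz
      · simp
      · refine (tendsto_gaussPrimitive_atTop.comp ?_).const_mul z
        have : Tendsto (fun s : ℝ => (z / 2) * s⁻¹) (𝓝[>] 0) atTop :=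
          tendsto_inv_nhdsGT_zero.const_mul_atTop (by positivity)
        refine this.congr fun s => ?_
        rw [← div_div]; rfl
    have := (h1.add h2).div_const √Real.pi
    rw [abs_of_nonneg hz]
    refine (this.congr fun s => rfl).trans_eq ?_
    congr 1
    field_simp
    ring
  rcases le_total 0 z with hz | hz
  · exact key z hz
  · have := key (-z) (by linarith)
    rw [abs_neg] at this
    refine this.congr fun s => ?_
    simp only [smoothAbs, neg_div, gaussPrimitive_neg]
    ring_nf

/-! ### The heat kernel and its time integral -/

theorem sqrt_four_pi_mul {θ t : ℝ} : √(4 * Real.pi * θ * t) = 2 * √Real.pi * √(θ * t) := by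
  rw [show 4 * Real.pi * θ * t = (2 ^ 2 * Real.pi) * (θ * t) by ring,
    Real.sqrt_mul (by positivity), Real.sqrt_mul (by positivity), Real.sqrt_sq (by norm_num)]

theorem heatKernel_eq {θ t : ℝ} (h : 0 < θ * t) (z : ℝ) :
    heatKernel θ t z = Real.exp (-(z / (2 * √(θ * t))) ^ 2) / (2 * √Real.pi * √(θ * t)) := by
  have : -z ^ 2 / (4 * θ * t) = -(z / (2 * √(θ * t))) ^ 2 := by
    rw [div_pow, mul_pow, Real.sq_sqrt h.le]
    ring
  rw [heatKernel, sqrt_four_pi_mul, this, div_eq_inv_mul _ (2 * √Real.pi * √(θ * t))]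

/-- Together with `hasDerivAt_deriv_smoothAbs` this is the heat equation for `smoothAbs √(θ t)`; it
provides the time primitive of the kernel. -/
theorem hasDerivAt_smoothAbs_time {θ t : ℝ} (hθ : 0 < θ) (ht : 0 < t) (z : ℝ) :
    HasDerivAt (fun t => smoothAbs √(θ * t) z) (θ * heatKernel θ t z) t := by
  have hp : 0 < θ * t := mul_pos hθ ht
  have h1 : HasDerivAt (fun t => √(θ * t)) (θ / (2 * √(θ * t))) t := by
    have := ((hasDerivAt_id t).const_mul θ).sqrt (by simpa using hp.ne')
    simpa using this
  have h2 := (hasDerivAt_smoothAbs_scale (Real.sqrt_pos.2 hp) z).comp t h1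
  refine h2.congr_deriv ?_
  rw [heatKernel_eq hp]
  have := Real.sqrt_pos.2 hp
  have := Real.sqrt_pos.2 Real.pi_pos
  field_simp

theorem hasDerivAt_deriv_smoothAbs {θ t : ℝ} (hp : 0 < θ * t) (z : ℝ) :
    HasDerivAt (fun z => gaussPrimitive (z / (2 * √(θ * t))) / √Real.pi) (heatKernel θ t z) z := by
  have h1 : HasDerivAt (fun z : ℝ => z / (2 * √(θ * t))) (1 / (2 * √(θ * t))) z :=
    (hasDerivAt_id z).div_const _
  have := ((hasDerivAt_gaussPrimitive _).comp z h1).div_const √Real.pi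
  refine this.congr_deriv ?_
  rw [heatKernel_eq hp]
  have := Real.sqrt_pos.2 hp
  have := Real.sqrt_pos.2 Real.pi_pos
  field_simp

theorem heatKernel_nonneg (θ t z : ℝ) : 0 ≤ heatKernel θ t z := by
  unfold heatKernel; positivity

theorem measurable_heatKernel (θ : ℝ) : Measurable fun p : ℝ × ℝ => heatKernel θ p.1 p.2 := by
  unfold heatKernel; fun_prop

theorem heatKernel_le {θ t : ℝ} (h : 0 < θ * t) (z : ℝ) :
    heatKernel θ t z ≤ (2 * √Real.pi * √(θ * t))⁻¹ := by
  rw [heatKernel_eq h, div_eq_inv_mul]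
  refine mul_le_of_le_one_right (by positivity) (Real.exp_le_one_iff.2 ?_)
  nlinarith [sq_nonneg (z / (2 * √(θ * t)))]

theorem intervalIntegrable_heatKernel {θ : ℝ} (hθ : 0 < θ) {t : ℝ} (ht : 0 < t) (z : ℝ) :
    IntervalIntegrable (fun r => heatKernel θ r z) volume 0 t := by
  have hi : IntervalIntegrable (fun r : ℝ => (2 * √Real.pi * √θ)⁻¹ * r ^ (-(1 / 2) : ℝ))
      volume 0 t :=
    (intervalIntegral.intervalIntegrable_rpow' (by norm_num)).const_mul _
  refine hi.mono_fun ?_ ?_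
  · exact ((measurable_heatKernel θ).comp
      (measurable_id.prodMk measurable_const)).aestronglyMeasurable
  · rw [Set.uIoc_of_le ht.le]
    filter_upwards [ae_restrict_mem measurableSet_Ioc] with r hr
    have hr0 : 0 < r := hr.1
    rw [Real.norm_of_nonneg (heatKernel_nonneg _ _ _), Real.norm_of_nonneg (by positivity)]
    refine (heatKernel_le (mul_pos hθ hr0) z).trans (le_of_eq ?_)
    rw [Real.sqrt_mul hθ.le, Real.rpow_neg hr0.le, ← Real.sqrt_eq_rpow]
    rw [← mul_inv, mul_assoc, mul_assoc, mul_assoc]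

/-- Fundamental theorem of calculus on `(0, t)`; the kink `|z| / 2` is the limit of the primitive at
time `0`. -/
theorem integral_heatKernel_time {θ : ℝ} (hθ : 0 < θ) {t : ℝ} (ht : 0 < t) (z : ℝ) :
    ∫ r in (0 : ℝ)..t, heatKernel θ r z = (smoothAbs √(θ * t) z - |z| / 2) / θ := by
  have h := intervalIntegral.integral_eq_sub_of_hasDerivAt_of_tendsto
    (f := fun t => smoothAbs √(θ * t) z) (f' := fun r => θ * heatKernel θ r z)
    (fa := |z| / 2) (fb := smoothAbs √(θ * t) z) ht
    (fun r hr => hasDerivAt_smoothAbs_time hθ hr.1 z)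
    ((intervalIntegrable_heatKernel hθ ht z).const_mul θ)
    ((tendsto_smoothAbs_zero z).comp ?_)
    ((hasDerivAt_smoothAbs_time hθ ht z).continuousAt.tendsto.mono_left nhdsWithin_le_nhds)
  · rw [intervalIntegral.integral_const_mul] at h
    rw [eq_div_iff hθ.ne', mul_comm, h]
  · refine tendsto_nhdsWithin_iff.2 ⟨?_, ?_⟩
    · have : Continuous fun t : ℝ => √(θ * t) := by fun_prop
      have := this.tendsto 0
      simp only [mul_zero, Real.sqrt_zero] at this
      exact this.mono_left nhdsWithin_le_nhds
    · filter_upwards [self_mem_nhdsWithin] with r hr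
      exact Real.sqrt_pos.2 (mul_pos hθ hr)

theorem integral_heatKernel {θ r : ℝ} (h : 0 < θ * r) : ∫ z, heatKernel θ r z = 1 := by
  have h1 : ∀ z, heatKernel θ r z =
      (√(4 * Real.pi * θ * r))⁻¹ * Real.exp (-(4 * θ * r)⁻¹ * z ^ 2) := by
    intro z
    rw [heatKernel]
    congr 2
    ring
  simp_rw [h1]
  rw [integral_const_mul, integral_gaussian, div_inv_eq_mul,
    show Real.pi * (4 * θ * r) = 4 * Real.pi * θ * r by ring, inv_mul_cancel₀]
  refine (Real.sqrt_pos.2 ?_).ne'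
  have := Real.pi_pos
  nlinarith [mul_pos this h]

theorem integrable_heatKernel {θ r : ℝ} (h : 0 < θ * r) : Integrable (heatKernel θ r) :=
  -- A non-integrable function has integral `0` by convention, so the value `1` forces
  -- integrability.
  Integrable.of_integral_ne_zero (by rw [integral_heatKernel h]; exact one_ne_zero)

/-! ### The heat potential in `L²(ℝ)` -/

/-- This is the semigroup property at the origin: the right side is `P(r + s, 0)`. -/
theorem inner_heatKernelL2 {θ r s : ℝ} (hθ : 0 < θ) (hr : 0 < r) (hs : 0 < s) (x : ℝ) :
    inner ℝ (heatKernelL2 θ r x) (heatKernelL2 θ s x) = (√(4 * Real.pi * θ * (r + s)))⁻¹ := by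
  have hpi := Real.pi_pos
  have h1 : ∀ z, heatKernel θ r z * heatKernel θ s z =
      ((√(4 * Real.pi * θ * r))⁻¹ * (√(4 * Real.pi * θ * s))⁻¹) *
        Real.exp (-((r + s) / (4 * θ * r * s)) * z ^ 2) := by
    intro z
    rw [heatKernel, heatKernel, mul_mul_mul_comm, ← Real.exp_add]
    congr 2
    field_simp
    ring
  have h2 : ∫ y, heatKernel θ r (x - y) * heatKernel θ s (x - y) =
      (√(4 * Real.pi * θ * (r + s)))⁻¹ := by
    rw [integral_sub_left_eq_self (fun z => heatKernel θ r z * heatKernel θ s z) volume x]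
    simp_rw [h1]
    rw [integral_const_mul, integral_gaussian, ← Real.sqrt_inv, ← Real.sqrt_inv, ← Real.sqrt_inv,
      ← Real.sqrt_mul (by positivity), ← Real.sqrt_mul (by positivity)]
    congr 1
    field_simp
  rw [← h2, L2.inner_def]
  refine integral_congr_ae ?_
  filter_upwards [(memLp_heatKernel θ r x).coeFn_toLp, (memLp_heatKernel θ s x).coeFn_toLp]
    with y hy1 hy2
  simp only [heatKernelL2, hy1, hy2, RCLike.inner_apply, conj_trivial]
  ring

/-- Expanding the squared norm of a difference leaves three explicit inner products, continuous in
the times. -/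
theorem continuousOn_heatKernelL2 {θ : ℝ} (hθ : 0 < θ) (x : ℝ) :
    ContinuousOn (fun r => heatKernelL2 θ r x) (Set.Ioi 0) := by
  intro r hr
  have hr : 0 < r := hr
  rw [ContinuousWithinAt, tendsto_iff_norm_sub_tendsto_zero]
  have hpi := Real.pi_pos
  have hc : ContinuousAt (fun s => (√(4 * Real.pi * θ * (s + s)))⁻¹
      - 2 * (√(4 * Real.pi * θ * (s + r)))⁻¹ + (√(4 * Real.pi * θ * (r + r)))⁻¹) r := by
    have : √(4 * Real.pi * θ * (r + r)) ≠ 0 := (Real.sqrt_pos.2 (by positivity)).ne'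
    fun_prop (disch := assumption)
  have h0 := (hc.tendsto.mono_left (nhdsWithin_le_nhds (s := Set.Ioi (0 : ℝ)))).sqrt
  rw [show ∀ q : ℝ, q - 2 * q + q = 0 by intro q; ring, Real.sqrt_zero] at h0
  refine h0.congr' ?_
  filter_upwards [self_mem_nhdsWithin] with s hs
  have hs : 0 < s := hs
  rw [← inner_heatKernelL2 hθ hs hs x, ← inner_heatKernelL2 hθ hs hr x,
    ← inner_heatKernelL2 hθ hr hr x, real_inner_self_eq_norm_sq, real_inner_self_eq_norm_sq,
    ← norm_sub_sq_real, Real.sqrt_sq (norm_nonneg _)]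

theorem norm_heatKernelL2 {θ r : ℝ} (hθ : 0 < θ) (hr : 0 < r) (x : ℝ) :
    ‖heatKernelL2 θ r x‖ = (8 * Real.pi * θ) ^ (-(1 / 4) : ℝ) * r ^ (-(1 / 4) : ℝ) := by
  have hpi := Real.pi_pos
  have h := inner_heatKernelL2 hθ hr hr x
  rw [real_inner_self_eq_norm_sq] at h
  rw [← Real.sqrt_sq (norm_nonneg (heatKernelL2 θ r x)), h,
    show 4 * Real.pi * θ * (r + r) = 8 * Real.pi * θ * r by ring,
    ← Real.mul_rpow (by positivity) hr.le, Real.sqrt_eq_rpow, Real.sqrt_eq_rpow,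
    ← Real.rpow_neg (by positivity), ← Real.rpow_mul (by positivity)]
  norm_num

theorem intervalIntegrable_heatKernelL2 {θ : ℝ} (hθ : 0 < θ) {t : ℝ} (ht : 0 < t) (x : ℝ) :
    IntervalIntegrable (fun r => heatKernelL2 θ r x) volume 0 t := by
  have hi : IntervalIntegrable
      (fun r : ℝ => (8 * Real.pi * θ) ^ (-(1 / 4) : ℝ) * r ^ (-(1 / 4) : ℝ)) volume 0 t :=
    (intervalIntegral.intervalIntegrable_rpow' (by norm_num)).const_mul _
  refine hi.mono_fun ?_ ?_
  · rw [Set.uIoc_of_le ht.le]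
    exact ((continuousOn_heatKernelL2 hθ x).mono Set.Ioc_subset_Ioi_self).aestronglyMeasurable
      measurableSet_Ioc
  · rw [Set.uIoc_of_le ht.le]
    filter_upwards [ae_restrict_mem measurableSet_Ioc] with r hr
    rw [norm_heatKernelL2 hθ hr.1 x]
    exact le_abs_self _

/-- The time integral `∫₀ᵗ P(r, x - ·) dr` of the heat kernel, as an element of `L²(ℝ)`. -/
noncomputable def heatPotentialL2 (θ t x : ℝ) : Lp ℝ 2 (volume : Measure ℝ) :=
  ∫ r in (0 : ℝ)..t, heatKernelL2 θ r x

theorem integrable_heatKernel_prod {θ : ℝ} (hθ : 0 < θ) {t : ℝ} (x : ℝ) :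
    Integrable (Function.uncurry fun r y => heatKernel θ r (x - y))
      ((volume.restrict (Set.Ioc 0 t)).prod volume) := by
  have hm : Measurable (Function.uncurry fun r y => heatKernel θ r (x - y)) :=
    (measurable_heatKernel θ).comp (measurable_fst.prodMk (measurable_const.sub measurable_snd))
  rw [integrable_prod_iff hm.aestronglyMeasurable]
  refine ⟨?_, ?_⟩
  · filter_upwards [ae_restrict_mem measurableSet_Ioc] with r hr
    exact (integrable_heatKernel (mul_pos hθ hr.1)).comp_sub_left x
  · have : Integrable (fun _ : ℝ => (1 : ℝ)) (volume.restrict (Set.Ioc 0 t)) :=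
      integrable_const _
    refine this.congr ?_
    filter_upwards [ae_restrict_mem measurableSet_Ioc] with r hr
    simp only [Function.uncurry, Real.norm_of_nonneg (heatKernel_nonneg _ _ _)]
    rw [integral_sub_left_eq_self (heatKernel θ r) volume x, integral_heatKernel (mul_pos hθ hr.1)]

/-- A Bochner integral in `L²(ℝ)` is not defined pointwise. Pairing with indicators of sets of
finite measure commutes with it, and Fubini then identifies it with the pointwise time integral. -/
theorem coeFn_heatPotentialL2 {θ : ℝ} (hθ : 0 < θ) {t : ℝ} (ht : 0 < t) (x : ℝ) :
    heatPotentialL2 θ t x =ᵐ[volume]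
      fun y => (smoothAbs √(θ * t) (x - y) - |x - y| / 2) / θ := by
  have hprod := integrable_heatKernel_prod hθ (t := t) x
  have hg : Integrable (fun y => (smoothAbs √(θ * t) (x - y) - |x - y| / 2) / θ) := by
    refine hprod.integral_prod_right.congr (Eventually.of_forall fun y => ?_)
    simp only [Function.uncurry]
    rw [← intervalIntegral.integral_of_le ht.le, integral_heatKernel_time hθ ht]
  refine AEFinStronglyMeasurable.ae_eq_of_forall_setIntegral_eq
    (fun s hs hμs => ?_) (fun s _ _ => hg.integrableOn) (fun s hs hμs => ?_)
    (Lp.finStronglyMeasurable _ (by norm_num) (by norm_num)).aefinStronglyMeasurable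
    hg.aefinStronglyMeasurable
  · exact integrableOn_Lp_of_measure_ne_top _ (by norm_num) hμs.ne
  · rw [← L2.inner_indicatorConstLp_one (𝕜 := ℝ) hs hμs.ne, heatPotentialL2]
    have h1 := ContinuousLinearMap.intervalIntegral_comp_comm
      (innerSL ℝ (indicatorConstLp 2 hs hμs.ne (1 : ℝ)))
      (intervalIntegrable_heatKernelL2 hθ ht x)
    simp only [innerSL_apply_apply] at h1
    rw [← h1]
    have h2 : ∀ r, inner ℝ (indicatorConstLp 2 hs hμs.ne (1 : ℝ)) (heatKernelL2 θ r x) =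
        ∫ y in s, heatKernel θ r (x - y) := by
      intro r
      rw [L2.inner_indicatorConstLp_one (𝕜 := ℝ) hs hμs.ne]
      exact integral_congr_ae (ae_restrict_of_ae (memLp_heatKernel θ r x).coeFn_toLp)
    simp_rw [h2, ← integral_heatKernel_time hθ ht]
    refine intervalIntegral_integral_swap ?_
    rw [Set.uIoc_of_le ht.le]
    exact hprod.mono_measure (Measure.prod_mono le_rfl Measure.restrict_le_self)

/-! ### Trapezoidal bumps and their inner products -/

/-- The trapezoidal function supported on `[0, p + q]`, the convolution of the indicators of
`[0, p]` and `[0, q]`, written as a second difference of the absolute value. -/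
noncomputable def trapezoid (p q y : ℝ) : ℝ := (|y| - |y - p| - |y - q| + |y - p - q|) / 2

theorem trapezoid_comm (p q y : ℝ) : trapezoid p q y = trapezoid q p y := by
  simp only [trapezoid, sub_right_comm y p q]
  ring

theorem continuous_trapezoid (p q : ℝ) : Continuous (trapezoid p q) := by
  unfold trapezoid; fun_prop

theorem trapezoid_eq_zero {p q : ℝ} (hp : 0 ≤ p) (hq : 0 ≤ q) {y : ℝ}
    (hy : y ∉ Set.Ioc 0 (p + q)) : trapezoid p q y = 0 := by
  rw [Set.mem_Ioc, not_and_or, not_lt, not_le] at hy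
  unfold trapezoid
  rcases hy with hy | hy
  · rw [abs_of_nonpos hy, abs_of_nonpos (by linarith : y - p ≤ 0),
      abs_of_nonpos (by linarith : y - q ≤ 0), abs_of_nonpos (by linarith : y - p - q ≤ 0)]
    ring
  · rw [abs_of_nonneg (by linarith : 0 ≤ y), abs_of_nonneg (by linarith : 0 ≤ y - p),
      abs_of_nonneg (by linarith : 0 ≤ y - q), abs_of_nonneg (by linarith : 0 ≤ y - p - q)]
    ring

/-- The graph has a ramp of slope `1` on `[0, p]`, a plateau of height `p` on `[p, q]` and a
symmetric ramp down, contributing `p³/3 + p² (q - p) + p³/3`. -/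
theorem integral_trapezoid_sq_of_le {p q : ℝ} (hp : 0 ≤ p) (hpq : p ≤ q) :
    ∫ y, trapezoid p q y ^ 2 = p ^ 2 * q - p ^ 3 / 3 := by
  have hc : Continuous fun y => trapezoid p q y ^ 2 := (continuous_trapezoid p q).pow 2
  rw [← setIntegral_eq_integral_of_forall_compl_eq_zero (s := Set.Ioc 0 (p + q)) fun y hy => by
      rw [trapezoid_eq_zero hp (hp.trans hpq) hy]; simp,
    ← intervalIntegral.integral_of_le (by linarith),
    ← intervalIntegral.integral_add_adjacent_intervals (hc.intervalIntegrable 0 p)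
      (hc.intervalIntegrable p (p + q)),
    ← intervalIntegral.integral_add_adjacent_intervals (hc.intervalIntegrable p q)
      (hc.intervalIntegrable q (p + q))]
  have h1 : ∫ y in (0 : ℝ)..p, trapezoid p q y ^ 2 = ∫ y in (0 : ℝ)..p, y ^ 2 := by
    refine intervalIntegral.integral_congr fun y hy => ?_
    rw [Set.uIcc_of_le hp] at hy
    obtain ⟨hy1, hy2⟩ := hy
    simp only [trapezoid]
    rw [abs_of_nonneg hy1, abs_of_nonpos (by linarith : y - p ≤ 0),
      abs_of_nonpos (by linarith : y - q ≤ 0), abs_of_nonpos (by linarith : y - p - q ≤ 0)]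
    ring
  have h2 : ∫ y in p..q, trapezoid p q y ^ 2 = ∫ y in p..q, p ^ 2 := by
    refine intervalIntegral.integral_congr fun y hy => ?_
    rw [Set.uIcc_of_le hpq] at hy
    obtain ⟨hy1, hy2⟩ := hy
    simp only [trapezoid]
    rw [abs_of_nonneg (hp.trans hy1), abs_of_nonneg (by linarith : 0 ≤ y - p),
      abs_of_nonpos (by linarith : y - q ≤ 0), abs_of_nonpos (by linarith : y - p - q ≤ 0)]
    ring
  have h3 : ∫ y in q..(p + q), trapezoid p q y ^ 2 = ∫ y in q..(p + q), (p + q - y) ^ 2 := by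
    refine intervalIntegral.integral_congr fun y hy => ?_
    rw [Set.uIcc_of_le (by linarith)] at hy
    obtain ⟨hy1, hy2⟩ := hy
    simp only [trapezoid]
    rw [abs_of_nonneg (by linarith : 0 ≤ y), abs_of_nonneg (by linarith : 0 ≤ y - p),
      abs_of_nonneg (by linarith : 0 ≤ y - q), abs_of_nonpos (by linarith : y - p - q ≤ 0)]
    ring
  rw [h1, h2, h3, intervalIntegral.integral_comp_sub_left (fun y => y ^ 2)]
  simp only [integral_pow, intervalIntegral.integral_const, smul_eq_mul]
  ring

theorem integral_trapezoid_sq {p q : ℝ} (hp : 0 ≤ p) (hq : 0 ≤ q) :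
    ∫ y, trapezoid p q y ^ 2 = min p q ^ 2 * max p q - min p q ^ 3 / 3 := by
  rcases le_total p q with h | h
  · rw [min_eq_left h, max_eq_right h, integral_trapezoid_sq_of_le hp h]
  · rw [min_eq_right h, max_eq_left h, ← integral_trapezoid_sq_of_le hq h]
    simp_rw [trapezoid_comm p q]

theorem memLp_trapezoid {p q : ℝ} (hp : 0 ≤ p) (hq : 0 ≤ q) (s : ℝ) :
    MemLp (fun y => trapezoid p q (y - s) / q) 2 (volume : Measure ℝ) := by
  refine Continuous.memLp_of_hasCompactSupport ?_ ?_
  · exact ((continuous_trapezoid p q).comp (continuous_id.sub continuous_const)).div_const q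
  · refine HasCompactSupport.of_support_subset_isCompact (isCompact_Icc (a := s) (b := s + p + q))
      fun y hy => ?_
    by_contra hy'
    refine hy ?_
    simp only
    rw [trapezoid_eq_zero hp hq, zero_div]
    intro h
    exact hy' ⟨by linarith [h.1], by linarith [h.2]⟩

/-- The average over a window of length `q` of the indicators of intervals of length `p`, the
support starting at `s`. -/
noncomputable def bumpL2 {p q : ℝ} (hp : 0 ≤ p) (hq : 0 ≤ q) (s : ℝ) :
    Lp ℝ 2 (volume : Measure ℝ) :=
  (memLp_trapezoid hp hq s).toLp _

theorem coeFn_bumpL2 {p q : ℝ} (hp : 0 ≤ p) (hq : 0 ≤ q) (s : ℝ) :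
    bumpL2 hp hq s =ᵐ[volume] fun y => trapezoid p q (y - s) / q :=
  (memLp_trapezoid hp hq s).coeFn_toLp

theorem inner_bumpL2 {p q : ℝ} (hp : 0 ≤ p) (hq : 0 ≤ q) (s s' : ℝ) :
    inner ℝ (bumpL2 hp hq s) (bumpL2 hp hq s') =
      ∫ y, trapezoid p q (y - s) / q * (trapezoid p q (y - s') / q) := by
  rw [L2.inner_def]
  refine integral_congr_ae ?_
  filter_upwards [coeFn_bumpL2 hp hq s, coeFn_bumpL2 hp hq s'] with y h1 h2
  rw [h1, h2, RCLike.inner_apply, conj_trivial, mul_comm]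

theorem norm_bumpL2_sq {p q : ℝ} (hp : 0 ≤ p) (hq : 0 ≤ q) (s : ℝ) :
    ‖bumpL2 hp hq s‖ ^ 2 = (min p q ^ 2 * max p q - min p q ^ 3 / 3) / q ^ 2 := by
  rw [← real_inner_self_eq_norm_sq, inner_bumpL2]
  rw [integral_sub_right_eq_self (fun y => trapezoid p q y / q * (trapezoid p q y / q)) s,
    ← integral_trapezoid_sq hp hq, ← integral_div]
  congr 1
  ext y
  rw [← sq, div_pow]

theorem inner_bumpL2_eq_zero {p q : ℝ} (hp : 0 ≤ p) (hq : 0 ≤ q) {s s' : ℝ}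
    (h : p + q ≤ |s - s'|) : inner ℝ (bumpL2 hp hq s) (bumpL2 hp hq s') = 0 := by
  rw [inner_bumpL2, integral_eq_zero_of_ae]
  refine Eventually.of_forall fun y => ?_
  by_cases h1 : y - s ∈ Set.Ioc 0 (p + q)
  · have h2 : y - s' ∉ Set.Ioc 0 (p + q) := by
      intro h2
      rcases le_abs.1 h with h | h
      · linarith [h1.1, h2.2]
      · linarith [h1.2, h2.1]
    simp [trapezoid_eq_zero hp hq h2]
  · simp [trapezoid_eq_zero hp hq h1]

/-! ### Second differences of the heat potential -/

/-- The mean value theorem is used twice: for `z ↦ f (z + p) - f z` over a step `q`, then for `f'`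
over a step `p`. -/
theorem exists_second_difference_eq {f f' f'' : ℝ → ℝ} (hf : ∀ z, HasDerivAt f (f' z) z)
    (hf' : ∀ z, HasDerivAt f' (f'' z) z) {p q : ℝ} (hp : 0 < p) (hq : 0 < q) (s : ℝ) :
    ∃ ξ ∈ Set.Icc s (s + p + q),
      (f (s + p + q) - f (s + p) - (f (s + q) - f s)) / q = p * f'' ξ := by
  have hg : ∀ z, HasDerivAt (fun z => f (z + p) - f z) (f' (z + p) - f' z) z := fun z =>
    ((hf (z + p)).comp_add_const z p).sub (hf z)
  obtain ⟨c, hc, hc'⟩ := exists_hasDerivAt_eq_slope (fun z => f (z + p) - f z) _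
    (by linarith : s < s + q) (fun z _ => (hg z).continuousAt.continuousWithinAt) fun z _ => hg z
  obtain ⟨d, hd, hd'⟩ := exists_hasDerivAt_eq_slope f' f''
    (by linarith : c < c + p) (fun z _ => (hf' z).continuousAt.continuousWithinAt) fun z _ => hf' z
  refine ⟨d, ⟨by linarith [hc.1, hd.1], by linarith [hc.2, hd.2]⟩, ?_⟩
  rw [hd', add_sub_cancel_left, mul_div_cancel₀ _ hp.ne', hc', add_sub_cancel_left,
    add_right_comm s q p]
  congr 1
  ring

/-- The intermediate point of the mean value theorem depends on the space variable. Doubling the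
time absorbs a bounded shift and yields a fixed square integrable majorant. -/
theorem heatKernel_le_of_near {θ t : ℝ} (hp : 0 < θ * t) {L ξ z : ℝ} (h : |ξ - z| ≤ L) :
    heatKernel θ t ξ ≤ √2 * Real.exp (L ^ 2 / (4 * θ * t)) * heatKernel θ (2 * t) z := by
  have hpi := Real.pi_pos
  rw [heatKernel, heatKernel, show 4 * Real.pi * θ * (2 * t) = 2 * (4 * Real.pi * θ * t) by ring,
    Real.sqrt_mul (by norm_num : (0 : ℝ) ≤ 2), mul_inv]
  have h2 : √2 * Real.exp (L ^ 2 / (4 * θ * t)) * ((√2)⁻¹ * (√(4 * Real.pi * θ * t))⁻¹ *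
      Real.exp (-z ^ 2 / (4 * θ * (2 * t)))) = (√(4 * Real.pi * θ * t))⁻¹ *
        Real.exp (L ^ 2 / (4 * θ * t) + -z ^ 2 / (4 * θ * (2 * t))) := by
    rw [Real.exp_add]
    field_simp
  rw [h2]
  refine mul_le_mul_of_nonneg_left (Real.exp_le_exp.2 ?_) (by positivity)
  rw [show -z ^ 2 / (4 * θ * (2 * t)) = (-z ^ 2 / 2) / (4 * θ * t) by
    rw [div_div]; ring_nf, ← add_div]
  refine div_le_div_of_nonneg_right ?_ (by nlinarith)
  have h3 : (ξ - z) ^ 2 ≤ L ^ 2 := sq_le_sq' (by linarith [(abs_le.1 h).1]) (abs_le.1 h).2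
  -- The inequality needed is `z² ≤ 2 ξ² + 2 (ξ - z)²`; the difference of its sides is `(2 ξ - z)²`.
  nlinarith [sq_nonneg (ξ + (ξ - z))]

/-- The `-|z| / 2` part gives exactly `-θ⁻¹` times the bump, and the smooth part gives `p P(t, ξ) /
θ`. The majorant of the latter is a translate of `P(2 t, ·)`, whose norm does not depend on `s`, so
`C` is uniform. -/
theorem exists_norm_second_difference_heatPotentialL2_le {θ : ℝ} (hθ : 0 < θ) {t : ℝ} (ht : 0 < t)
    (L : ℝ) : ∃ C, ∀ (p q : ℝ) (hp : 0 < p) (hq : 0 < q) (s : ℝ), p + q ≤ L →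
      ‖q⁻¹ • ((heatPotentialL2 θ t (s + p + q) - heatPotentialL2 θ t (s + p)) -
        (heatPotentialL2 θ t (s + q) - heatPotentialL2 θ t s)) + θ⁻¹ • bumpL2 hp.le hq.le s‖
        ≤ C * p := by
  have hpos : 0 < θ * t := mul_pos hθ ht
  set K := √2 * Real.exp (L ^ 2 / (4 * θ * t)) with hK
  refine ⟨K / θ * ((8 * Real.pi * θ) ^ (-(1 / 4) : ℝ) * (2 * t) ^ (-(1 / 4) : ℝ)),
    fun p q hp hq s hL => ?_⟩
  rw [← norm_heatKernelL2 hθ (by positivity : 0 < 2 * t) s, mul_right_comm]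
  refine Lp.norm_le_mul_norm_of_ae_le_mul ?_
  set x1 := heatPotentialL2 θ t (s + p + q)
  set x2 := heatPotentialL2 θ t (s + p)
  set x3 := heatPotentialL2 θ t (s + q)
  set x4 := heatPotentialL2 θ t s
  filter_upwards [coeFn_heatPotentialL2 hθ ht (s + p + q), coeFn_heatPotentialL2 hθ ht (s + p),
    coeFn_heatPotentialL2 hθ ht (s + q), coeFn_heatPotentialL2 hθ ht s,
    coeFn_bumpL2 hp.le hq.le s, (memLp_heatKernel θ (2 * t) s).coeFn_toLp,
    Lp.coeFn_add (q⁻¹ • ((x1 - x2) - (x3 - x4))) (θ⁻¹ • bumpL2 hp.le hq.le s),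
    Lp.coeFn_smul q⁻¹ ((x1 - x2) - (x3 - x4)), Lp.coeFn_smul θ⁻¹ (bumpL2 hp.le hq.le s),
    Lp.coeFn_sub (x1 - x2) (x3 - x4), Lp.coeFn_sub x1 x2, Lp.coeFn_sub x3 x4]
    with y h1 h2 h3 h4 h5 h6 h7 h8 h9 h10 h11 h12
  rw [h7, Pi.add_apply, h8, h9, Pi.smul_apply, Pi.smul_apply, h10, Pi.sub_apply, h11, h12,
    Pi.sub_apply, Pi.sub_apply, h1, h2, h3, h4, h5, heatKernelL2, h6,
    Real.norm_of_nonneg (heatKernel_nonneg _ _ _)]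
  obtain ⟨ξ, hξ, hξ'⟩ := exists_second_difference_eq
    (hasDerivAt_smoothAbs (Real.sqrt_pos.2 hpos)) (hasDerivAt_deriv_smoothAbs hpos) hp hq (s - y)
  have hval : q⁻¹ • ((smoothAbs √(θ * t) (s + p + q - y) - |s + p + q - y| / 2) / θ -
        (smoothAbs √(θ * t) (s + p - y) - |s + p - y| / 2) / θ -
      ((smoothAbs √(θ * t) (s + q - y) - |s + q - y| / 2) / θ -
        (smoothAbs √(θ * t) (s - y) - |s - y| / 2) / θ)) + θ⁻¹ • (trapezoid p q (y - s) / q) =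
      p * heatKernel θ t ξ / θ := by
    rw [← hξ', trapezoid, abs_sub_comm (s + p + q), abs_sub_comm (s + p), abs_sub_comm (s + q),
      abs_sub_comm s, show y - (s + p + q) = y - s - p - q by ring,
      show y - (s + p) = y - s - p by ring, show y - (s + q) = y - s - q by ring,
      show s + p + q - y = s - y + p + q by ring, show s + p - y = s - y + p by ring,
      show s + q - y = s - y + q by ring, smul_eq_mul, smul_eq_mul]
    field_simp
    ring
  rw [hval, Real.norm_of_nonneg (by have := heatKernel_nonneg θ t ξ; positivity)]
  have hle := heatKernel_le_of_near hpos (L := L) (ξ := ξ) (z := s - y) (by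
    rw [abs_of_nonneg (by linarith [hξ.1])]; linarith [hξ.2])
  calc p * heatKernel θ t ξ / θ ≤ p * (K * heatKernel θ (2 * t) (s - y)) / θ := by gcongr
    _ = K / θ * p * heatKernel θ (2 * t) (s - y) := by ring

/-! ### The Wiener isometry and the mild solution -/

variable {Ω : Type*} [MeasurableSpace Ω] {P : Measure Ω}
  {W : Lp ℝ 2 (volume : Measure ℝ) → Ω → ℝ}

theorem IsWhiteNoise.inner_wienerIntegral (hW : IsWhiteNoise W P)
    (f g : Lp ℝ 2 (volume : Measure ℝ)) :
    inner ℝ (hW.wienerIntegral f) (hW.wienerIntegral g) = inner ℝ f g := by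
  rw [← hW.covariance, L2.inner_def]
  refine integral_congr_ae ?_
  filter_upwards [(hW.memLp f).coeFn_toLp, (hW.memLp g).coeFn_toLp] with ω h1 h2
  rw [IsWhiteNoise.wienerIntegral, IsWhiteNoise.wienerIntegral, h1, h2, RCLike.inner_apply,
    conj_trivial, mul_comm]

/-- The Wiener integral as a linear isometry from `L²(ℝ)` to `L²(Ω)`. -/
noncomputable def IsWhiteNoise.wienerIsometry (hW : IsWhiteNoise W P) :
    Lp ℝ 2 (volume : Measure ℝ) →ₗᵢ[ℝ] Lp ℝ 2 P :=
  LinearMap.isometryOfInner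
    { toFun := hW.wienerIntegral
      map_add' := fun f g => by
        -- Linearity of `W` is not assumed; it follows from the covariance, since the defect has
        -- zero norm in `L²(Ω)`.
        rw [← sub_eq_zero, ← inner_self_eq_zero (𝕜 := ℝ)]
        simp only [inner_sub_left, inner_sub_right, inner_add_left, inner_add_right,
          hW.inner_wienerIntegral]
        ring
      map_smul' := fun c f => by
        rw [← sub_eq_zero, ← inner_self_eq_zero (𝕜 := ℝ)]
        simp only [inner_sub_left, inner_sub_right, real_inner_smul_left, real_inner_smul_right,
          hW.inner_wienerIntegral, RingHom.id_apply]
        ring }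
    hW.inner_wienerIntegral

theorem IsWhiteNoise.coeFn_wienerIsometry (hW : IsWhiteNoise W P)
    (f : Lp ℝ 2 (volume : Measure ℝ)) : hW.wienerIsometry f =ᵐ[P] W f :=
  (hW.memLp f).coeFn_toLp

/-- The isometry commutes with the Bochner integral, and time is reversed by `r = t - s`. -/
theorem IsMildSolution.eq_heatPotentialL2 {θ σ : ℝ} {hW : IsWhiteNoise W P} {u : ℝ → ℝ → Ω → ℝ}
    (hu : IsMildSolution θ σ hW u) {t : ℝ} (ht : 0 < t) (x : ℝ) :
    u t x =ᵐ[P] fun ω => σ * hW.wienerIsometry (heatPotentialL2 θ t x) ω := by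
  have h1 : ∫ s in (0 : ℝ)..t, hW.wienerIntegral (heatKernelL2 θ (t - s) x) =
      hW.wienerIsometry (heatPotentialL2 θ t x) := by
    have h := intervalIntegral.integral_comp_sub_left (a := 0) (b := t)
      (fun r => hW.wienerIsometry (heatKernelL2 θ r x)) t
    rw [sub_self, sub_zero] at h
    rw [heatPotentialL2, ← LinearIsometry.intervalIntegral_comp_comm, ← h]
    rfl
  refine (hu t ht x).trans ?_
  rw [h1]
  filter_upwards [Lp.coeFn_smul σ (hW.wienerIsometry (heatPotentialL2 θ t x))] with ω h
  rw [h, Pi.smul_apply, smul_eq_mul]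

/-! ### Squares of Gaussian variables: moments, covariances, fluctuations -/

/-- Cauchy–Schwarz for `|X² - Y²| = |X - Y| |X + Y|`. -/
theorem integral_abs_sq_sub_sq_le (X Y : Lp ℝ 2 P) :
    Integrable (fun ω => X ω ^ 2 - Y ω ^ 2) P ∧
    ∫ ω, |X ω ^ 2 - Y ω ^ 2| ∂P ≤ ‖X - Y‖ * ‖X + Y‖ := by
  have hX := Lp.memLp X
  have hY := Lp.memLp Y
  refine ⟨hX.integrable_sq.sub hY.integrable_sq, ?_⟩
  have h1 : ∫ ω, |X ω ^ 2 - Y ω ^ 2| ∂P = inner ℝ (|X - Y|) (|X + Y|) := by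
    rw [L2.inner_def]
    refine integral_congr_ae ?_
    filter_upwards [Lp.coeFn_abs (X - Y), Lp.coeFn_abs (X + Y), Lp.coeFn_sub X Y,
      Lp.coeFn_add X Y] with ω h1 h2 h3 h4
    rw [h1, h2, h3, h4, RCLike.inner_apply, conj_trivial, Pi.sub_apply, Pi.add_apply, ← abs_mul]
    congr 1
    ring
  rw [h1]
  refine (real_inner_le_norm _ _).trans_eq ?_
  rw [norm_abs_eq_norm, norm_abs_eq_norm]

theorem IsWhiteNoise.integral_sq (hW : IsWhiteNoise W P) (f : Lp ℝ 2 (volume : Measure ℝ)) :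
    ∫ ω, W f ω ^ 2 ∂P = ‖f‖ ^ 2 := by
  rw [← real_inner_self_eq_norm_sq, ← hW.covariance]
  simp_rw [sq]

theorem IsWhiteNoise.hasLaw (hW : IsWhiteNoise W P) (f : Lp ℝ 2 (volume : Measure ℝ)) :
    P.map (W f) = (gaussianReal 0 1).map (fun x => ‖f‖ * x) := by
  have hprob := hW.gaussian.isProbabilityMeasure
  have hg := hW.gaussian.hasGaussianLaw_eval f
  rw [hg.map_eq_gaussianReal, hW.mean_zero, gaussianReal_map_const_mul, mul_zero, mul_one,
    variance_eq_sub hg.memLp_two, hW.mean_zero]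
  congr 1
  ext
  simp only [Pi.pow_apply, hW.integral_sq]
  simp

theorem IsWhiteNoise.integral_pow_four (hW : IsWhiteNoise W P)
    (f : Lp ℝ 2 (volume : Measure ℝ)) :
    ∫ ω, W f ω ^ 4 ∂P = (‖f‖ ^ 2) ^ 2 * ∫ x, x ^ 4 ∂gaussianReal 0 1 := by
  have h1 := integral_map (hW.gaussian.aemeasurable f) (f := fun x : ℝ => x ^ 4)
    (by fun_prop)
  rw [← h1, hW.hasLaw, integral_map (by fun_prop) (by fun_prop), ← integral_const_mul]
  congr 1
  ext x
  ring

theorem IsWhiteNoise.integrable_pow_four (hW : IsWhiteNoise W P)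
    (f : Lp ℝ 2 (volume : Measure ℝ)) : Integrable (fun ω => W f ω ^ 4) P := by
  have hprob := hW.gaussian.isProbabilityMeasure
  have h := ((hW.gaussian.hasGaussianLaw_eval f).memLp (p := 4) (by norm_num)).integrable_norm_pow
    (p := 4) (by norm_num)
  refine h.congr (Eventually.of_forall fun ω => ?_)
  simp only [Real.norm_eq_abs]
  exact Even.pow_abs (by decide) _

theorem IsWhiteNoise.memLp_sq (hW : IsWhiteNoise W P)
    (f : Lp ℝ 2 (volume : Measure ℝ)) : MemLp (fun ω => W f ω ^ 2) 2 P := by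
  rw [memLp_two_iff_integrable_sq (by
    exact ((hW.gaussian.aemeasurable f).pow_const 2).aestronglyMeasurable)]
  simpa only [← pow_mul] using hW.integrable_pow_four f

/-- A crude bound: the product of the means is dropped and `X² Y² ≤ (X⁴ + Y⁴) / 2`. -/
theorem IsWhiteNoise.covariance_sq_le (hW : IsWhiteNoise W P)
    {f g : Lp ℝ 2 (volume : Measure ℝ)} (hfg : ‖f‖ ^ 2 = ‖g‖ ^ 2) :
    cov[fun ω => W f ω ^ 2, fun ω => W g ω ^ 2; P] ≤
      (‖g‖ ^ 2) ^ 2 * ∫ x, x ^ 4 ∂gaussianReal 0 1 := by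
  have hprob := hW.gaussian.isProbabilityMeasure
  rw [covariance_eq_sub (hW.memLp_sq f) (hW.memLp_sq g), hW.integral_sq, hW.integral_sq]
  have h1 : ∫ ω, W f ω ^ 2 * W g ω ^ 2 ∂P ≤ ∫ ω, (W f ω ^ 4 + W g ω ^ 4) / 2 ∂P := by
    refine integral_mono ((hW.memLp_sq f).integrable_mul (hW.memLp_sq g))
      (((hW.integrable_pow_four f).add (hW.integrable_pow_four g)).div_const 2) fun ω => ?_
    simp only
    nlinarith [sq_nonneg (W f ω ^ 2 - W g ω ^ 2)]
  rw [integral_div, integral_add (hW.integrable_pow_four f) (hW.integrable_pow_four g),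
    hW.integral_pow_four, hW.integral_pow_four, hfg] at h1
  have h2 : (0 : ℝ) ≤ ‖f‖ ^ 2 * ‖g‖ ^ 2 := by positivity
  simp only [Pi.mul_apply]
  linarith

/-- Orthogonal functions have uncorrelated, jointly Gaussian, hence independent Wiener integrals. -/
theorem IsWhiteNoise.covariance_sq_eq_zero (hW : IsWhiteNoise W P)
    {f g : Lp ℝ 2 (volume : Measure ℝ)} (hfg : inner ℝ f g = 0) :
    cov[fun ω => W f ω ^ 2, fun ω => W g ω ^ 2; P] = 0 := by
  have hprob := hW.gaussian.isProbabilityMeasure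
  have hcov : cov[W f, W g; P] = 0 := by
    rw [covariance_eq_sub (hW.memLp f) (hW.memLp g), hW.mean_zero, hW.mean_zero]
    simp only [Pi.mul_apply, hW.covariance, hfg]
    ring
  have hind := (hW.gaussian.hasGaussianLaw_prodMk (s := f) (t := g)).indepFun_of_covariance_eq_zero
    hcov
  exact (hind.comp (φ := fun x : ℝ => x ^ 2) (ψ := fun x : ℝ => x ^ 2) (by fun_prop)
    (by fun_prop)).covariance_eq_zero (hW.memLp_sq f) (hW.memLp_sq g)

/-- In each row of the covariance matrix at most five entries survive, those with `|i - k| ≤ 2`, so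
the variance grows linearly in the number of terms. -/
theorem IsWhiteNoise.variance_sum_sq_le (hW : IsWhiteNoise W P) (I : Finset ℕ)
    (ψ : ℕ → Lp ℝ 2 (volume : Measure ℝ)) (m : ℝ) (hm : ∀ i, ‖ψ i‖ ^ 2 = m)
    (horth : ∀ i k, i + 3 ≤ k ∨ k + 3 ≤ i → inner ℝ (ψ i) (ψ k) = 0) :
    Var[fun ω => ∑ i ∈ I, W (ψ i) ω ^ 2; P] ≤
      I.card * (5 * (m ^ 2 * ∫ x, x ^ 4 ∂gaussianReal 0 1)) := by
  have hprob := hW.gaussian.isProbabilityMeasure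
  set K := ∫ x, x ^ 4 ∂gaussianReal 0 1
  have hK : 0 ≤ m ^ 2 * K :=
    mul_nonneg (sq_nonneg _) (integral_nonneg fun x => by positivity)
  rw [variance_fun_sum' (fun i _ => hW.memLp_sq (ψ i)), ← nsmul_eq_mul]
  refine Finset.sum_le_card_nsmul _ _ _ fun i _ => ?_
  calc ∑ k ∈ I, cov[fun ω => W (ψ i) ω ^ 2, fun ω => W (ψ k) ω ^ 2; P]
      ≤ ∑ k ∈ I, if k ∈ Finset.Icc (i - 2) (i + 2) then m ^ 2 * K else 0 := by
        refine Finset.sum_le_sum fun k _ => ?_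
        split_ifs with h
        · rw [← hm k]
          exact hW.covariance_sq_le (by rw [hm, hm])
        · rw [Finset.mem_Icc] at h
          exact (hW.covariance_sq_eq_zero (horth i k (by omega))).le
    _ = (I.filter (· ∈ Finset.Icc (i - 2) (i + 2))).card * (m ^ 2 * K) := by
        rw [← Finset.sum_filter, Finset.sum_const, nsmul_eq_mul]
    _ ≤ 5 * (m ^ 2 * K) := by
        refine mul_le_mul_of_nonneg_right ?_ hK
        have : (I.filter (· ∈ Finset.Icc (i - 2) (i + 2))).card
            ≤ (Finset.Icc (i - 2) (i + 2)).card :=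
          Finset.card_le_card fun k hk => (Finset.mem_filter.1 hk).2
        rw [Nat.card_Icc] at this
        exact_mod_cast this.trans (by omega)

/-- Nonnegativity of the variance of `|X - E X|` gives the comparison of its first and second
moments. -/
theorem integral_abs_sub_integral_le_sqrt_variance [IsProbabilityMeasure P] {X : Ω → ℝ}
    (hX : MemLp X 2 P) : ∫ ω, |X ω - ∫ ω', X ω' ∂P| ∂P ≤ √Var[X; P] := by
  have hY : MemLp (fun ω => |X ω - ∫ ω', X ω' ∂P|) 2 P := (hX.sub (memLp_const _)).abs
  refine Real.le_sqrt_of_sq_le ?_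
  have h := variance_nonneg (fun ω => |X ω - ∫ ω', X ω' ∂P|) P
  rw [variance_eq_sub hY] at h
  rw [variance_eq_integral hX.aemeasurable]
  simpa only [Pi.pow_apply, sq_abs, sub_nonneg] using h

theorem IsWhiteNoise.integral_abs_sum_sq_sub_le (hW : IsWhiteNoise W P) (I : Finset ℕ)
    (ψ : ℕ → Lp ℝ 2 (volume : Measure ℝ)) (m : ℝ) (hm : ∀ i, ‖ψ i‖ ^ 2 = m)
    (horth : ∀ i k, i + 3 ≤ k ∨ k + 3 ≤ i → inner ℝ (ψ i) (ψ k) = 0) :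
    ∫ ω, |∑ i ∈ I, W (ψ i) ω ^ 2 - I.card * m| ∂P ≤
      √(I.card * (5 * (m ^ 2 * ∫ x, x ^ 4 ∂gaussianReal 0 1))) := by
  have hprob := hW.gaussian.isProbabilityMeasure
  have h := integral_abs_sub_integral_le_sqrt_variance
    (memLp_finsetSum I fun i _ => hW.memLp_sq (ψ i))
  have hmean : ∫ ω, ∑ i ∈ I, W (ψ i) ω ^ 2 ∂P = I.card * m := by
    rw [integral_finsetSum _ fun i _ => (hW.memLp_sq (ψ i)).integrable (by norm_num)]
    simp only [hW.integral_sq, hm, Finset.sum_const, nsmul_eq_mul]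
  rw [hmean] at h
  exact h.trans (Real.sqrt_le_sqrt (hW.variance_sum_sq_le I ψ m hm horth))

/-- Each `g i` is compared with `-c • ψ i`, whose sign disappears on squaring. The difference of
squares costs `r` times the norm of the sum, at most `r + 2 c √m`; the rest is the fluctuation of
the unperturbed sum. -/
theorem IsWhiteNoise.integral_abs_perturbed_sum_sq_sub_le (hW : IsWhiteNoise W P) (I : Finset ℕ)
    (ψ g : ℕ → Lp ℝ 2 (volume : Measure ℝ)) (m c r : ℝ) (hc : 0 ≤ c) (hm : ∀ i, ‖ψ i‖ ^ 2 = m)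
    (horth : ∀ i k, i + 3 ≤ k ∨ k + 3 ≤ i → inner ℝ (ψ i) (ψ k) = 0)
    (hg : ∀ i, ‖g i + c • ψ i‖ ≤ r) :
    Integrable (fun ω => ∑ i ∈ I, hW.wienerIsometry (g i) ω ^ 2 - I.card * (c ^ 2 * m)) P ∧
    ∫ ω, |∑ i ∈ I, hW.wienerIsometry (g i) ω ^ 2 - I.card * (c ^ 2 * m)| ∂P ≤
      I.card * (r * (r + 2 * c * √m)) +
      c ^ 2 * √(I.card * (5 * (m ^ 2 * ∫ x, x ^ 4 ∂gaussianReal 0 1))) := by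
  have hprob := hW.gaussian.isProbabilityMeasure
  set T := hW.wienerIsometry
  have hint : Integrable (fun ω => ∑ i ∈ I, T (g i) ω ^ 2 - I.card * (c ^ 2 * m)) P :=
    (integrable_finsetSum _ fun i _ => (Lp.memLp (T (g i))).integrable_sq).sub (integrable_const _)
  refine ⟨hint, ?_⟩
  have hψint : Integrable (fun ω => |∑ i ∈ I, W (ψ i) ω ^ 2 - I.card * m|) P :=
    ((integrable_finsetSum _ fun i _ => (hW.memLp (ψ i)).integrable_sq).sub
      (integrable_const _)).abs
  have hdint : ∀ i, Integrable (fun ω => |T (g i) ω ^ 2 - T (-(c • ψ i)) ω ^ 2|) P := fun i =>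
    (integral_abs_sq_sub_sq_le _ _).1.abs
  have hd : ∀ i, ∫ ω, |T (g i) ω ^ 2 - T (-(c • ψ i)) ω ^ 2| ∂P ≤ r * (r + 2 * c * √m) := by
    intro i
    refine (integral_abs_sq_sub_sq_le _ _).2.trans ?_
    rw [← map_sub, ← map_add, LinearIsometry.norm_map, LinearIsometry.norm_map, sub_neg_eq_add]
    have hr : 0 ≤ r := (norm_nonneg _).trans (hg i)
    have h2 : ‖g i + -(c • ψ i)‖ ≤ r + 2 * c * √m := by
      have : g i + -(c • ψ i) = (g i + c • ψ i) - (2 * c) • ψ i := by module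
      rw [this]
      refine (norm_sub_le _ _).trans (add_le_add (hg i) ?_)
      rw [norm_smul, Real.norm_of_nonneg (by positivity), ← hm i, Real.sqrt_sq (norm_nonneg _)]
    gcongr
    exact hg i
  have hae : ∀ᵐ ω ∂P, ∀ i ∈ I, T (-(c • ψ i)) ω = -(c * W (ψ i) ω) := by
    rw [Filter.eventually_all_finset]
    intro i _
    rw [map_neg, map_smul]
    filter_upwards [Lp.coeFn_neg (c • T (ψ i)), Lp.coeFn_smul c (T (ψ i)),
      hW.coeFn_wienerIsometry (ψ i)] with ω h1 h2 h3
    rw [h1, Pi.neg_apply, h2, Pi.smul_apply, h3, smul_eq_mul]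
  calc ∫ ω, |∑ i ∈ I, T (g i) ω ^ 2 - I.card * (c ^ 2 * m)| ∂P
      ≤ ∫ ω, (∑ i ∈ I, |T (g i) ω ^ 2 - T (-(c • ψ i)) ω ^ 2| +
          c ^ 2 * |∑ i ∈ I, W (ψ i) ω ^ 2 - I.card * m|) ∂P := by
        refine integral_mono_ae hint.abs
          ((integrable_finsetSum _ fun i _ => hdint i).add (hψint.const_mul _)) ?_
        filter_upwards [hae] with ω hω
        have h1 : ∑ i ∈ I, T (g i) ω ^ 2 - I.card * (c ^ 2 * m) =
            ∑ i ∈ I, (T (g i) ω ^ 2 - T (-(c • ψ i)) ω ^ 2) +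
              c ^ 2 * (∑ i ∈ I, W (ψ i) ω ^ 2 - I.card * m) := by
          have h2 : ∑ i ∈ I, T (-(c • ψ i)) ω ^ 2 = c ^ 2 * ∑ i ∈ I, W (ψ i) ω ^ 2 := by
            rw [Finset.mul_sum]
            refine Finset.sum_congr rfl fun i hi => ?_
            rw [hω i hi]
            ring
          rw [Finset.sum_sub_distrib, h2]
          ring
        rw [h1]
        refine (abs_add_le _ _).trans (add_le_add (Finset.abs_sum_le_sum_abs _ _) ?_)
        rw [abs_mul, abs_of_nonneg (sq_nonneg c)]
    _ = ∑ i ∈ I, ∫ ω, |T (g i) ω ^ 2 - T (-(c • ψ i)) ω ^ 2| ∂P +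
          c ^ 2 * ∫ ω, |∑ i ∈ I, W (ψ i) ω ^ 2 - I.card * m| ∂P := by
        rw [integral_add (integrable_finsetSum _ fun i _ => hdint i) (hψint.const_mul _),
          integral_finsetSum _ fun i _ => hdint i, integral_const_mul]
    _ ≤ _ := by
        refine add_le_add ?_ (mul_le_mul_of_nonneg_left
          (hW.integral_abs_sum_sq_sub_le I ψ m hm horth) (sq_nonneg c))
        rw [← nsmul_eq_mul]
        exact Finset.sum_le_card_nsmul _ _ _ fun i _ => hd i

/-! ### The bias factor as a limit of bump norms -/

/-- The squared `L²` norm of a bump relative to its mass `p`, as a function of the ratio `q / p`. -/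
noncomputable def bumpRatio (c : ℝ) : ℝ :=
  (min 1 c ^ 2 * max 1 c - min 1 c ^ 3 / 3) / c ^ 2

theorem norm_bumpL2_sq_eq_bumpRatio {p q : ℝ} (hp : 0 < p) (hq : 0 < q) (s : ℝ) :
    ‖bumpL2 hp.le hq.le s‖ ^ 2 = p * bumpRatio (q / p) := by
  have h1 : min p q = p * min 1 (q / p) := by
    rw [mul_min_of_nonneg _ _ hp.le, mul_one, mul_div_cancel₀ _ hp.ne']
  have h2 : max p q = p * max 1 (q / p) := by
    rw [mul_max_of_nonneg _ _ hp.le, mul_one, mul_div_cancel₀ _ hp.ne']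
  rw [norm_bumpL2_sq, h1, h2, bumpRatio]
  field_simp

theorem bumpRatio_of_le_one {c : ℝ} (hc : 0 < c) (h : c ≤ 1) : bumpRatio c = 1 - c / 3 := by
  rw [bumpRatio, min_eq_right h, max_eq_left h]
  field_simp

theorem bumpRatio_of_one_le {c : ℝ} (h : 1 ≤ c) :
    bumpRatio c = 1 / c - 1 / (3 * c ^ 2) := by
  have : 0 < c := by linarith
  rw [bumpRatio, min_eq_left h, max_eq_right h]
  field_simp

theorem biasFactor_pos {a b γ : ℝ} (hab : 0 < a + b) : 0 < biasFactor a b γ := by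
  unfold biasFactor
  split_ifs with h1 h2
  · rw [show 1 / (a + b) - 1 / (3 * (a + b) ^ 2) = (3 * (a + b) - 1) / (3 * (a + b) ^ 2) by
      field_simp]
    exact div_pos (by linarith) (by positivity)
  · linarith
  · exact one_pos

/-- The argument is `q / p`. It is constant for `γ = 1`; for `γ > 1` it tends to `0`, where
`bumpRatio c = 1 - c / 3` tends to `1`. -/
theorem tendsto_bumpRatio {a b γ : ℝ} (hab : 0 < a + b) (hγ : 1 ≤ γ) :
    Tendsto (fun N : ℕ => bumpRatio ((a + b) * (N : ℝ) ^ (1 - γ))) atTop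
      (𝓝 (biasFactor a b γ)) := by
  rcases hγ.eq_or_lt with rfl | hγ
  · simp only [sub_self, Real.rpow_zero, mul_one, biasFactor, if_true]
    split_ifs with h
    · rw [bumpRatio_of_one_le h]; exact tendsto_const_nhds
    · rw [bumpRatio_of_le_one hab (not_le.1 h).le]; exact tendsto_const_nhds
  · rw [biasFactor, if_neg hγ.ne']
    have h0 : Tendsto (fun N : ℕ => (a + b) * (N : ℝ) ^ (1 - γ)) atTop (𝓝 0) := by
      have := (tendsto_rpow_neg_atTop (by linarith : 0 < γ - 1)).comp
        (tendsto_natCast_atTop_atTop (R := ℝ))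
      simpa [Function.comp_def] using this.const_mul (a + b)
    have h1 := (h0.div_const 3).const_sub 1
    rw [zero_div, sub_zero] at h1
    refine h1.congr' ?_
    filter_upwards [h0.eventually_le_const one_pos, eventually_gt_atTop 0] with N hN hN0
    have : (0 : ℝ) < N := by exact_mod_cast hN0
    rw [bumpRatio_of_le_one (by positivity) hN]

/-! ### Convergence in probability to a constant -/

theorem tendstoInMeasure_of_integral_abs {f : ℕ → Ω → ℝ} {c : ℝ}
    (hint : ∀ N, Integrable (fun ω => f N ω - c) P)
    (h : Tendsto (fun N => ∫ ω, |f N ω - c| ∂P) atTop (𝓝 0)) :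
    TendstoInMeasure P f atTop fun _ => c := by
  have h1 : TendstoInMeasure P (fun N ω => f N ω - c) atTop fun _ => (0 : ℝ) := by
    refine tendstoInMeasure_of_tendsto_eLpNorm one_ne_zero
      (fun N => (hint N).aestronglyMeasurable) aestronglyMeasurable_const ?_
    have h2 := ENNReal.tendsto_ofReal h
    rw [ENNReal.ofReal_zero] at h2
    refine h2.congr fun N => ?_
    rw [eLpNorm_one_eq_lintegral_enorm]
    simp only [← Real.norm_eq_abs]
    rw [ofReal_integral_norm_eq_lintegral_enorm (hint N)]
    simp
  rw [tendstoInMeasure_iff_norm] at h1 ⊢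
  simpa using h1

/-- Continuous mapping theorem for convergence in probability to a constant. -/
theorem tendstoInMeasure_comp_continuousAt {f : ℕ → Ω → ℝ} {c : ℝ}
    (h : TendstoInMeasure P f atTop fun _ => c) {φ : ℝ → ℝ} (hφ : ContinuousAt φ c) :
    TendstoInMeasure P (fun N ω => φ (f N ω)) atTop fun _ => φ c := by
  rw [tendstoInMeasure_iff_dist] at h ⊢
  intro ε hε
  obtain ⟨δ, hδ, hφδ⟩ := Metric.continuousAt_iff.1 hφ ε hε
  refine tendsto_of_tendsto_of_tendsto_of_le_of_le tendsto_const_nhds (h δ hδ)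
    (fun _ => zero_le) fun N => measure_mono fun ω hω => ?_
  by_contra hlt
  exact absurd (hφδ (not_le.1 hlt)) (not_lt.2 hω)

/-! ### Convergence of the discrete variation -/

/-- Normalised second difference of the heat potential, at the points `s`, `s + q`, `s + p`,
`s + p + q`. -/
noncomputable def heatPotentialIncr (θ t p q s : ℝ) : Lp ℝ 2 (volume : Measure ℝ) :=
  q⁻¹ • ((heatPotentialL2 θ t (s + p + q) - heatPotentialL2 θ t (s + p)) -
    (heatPotentialL2 θ t (s + q) - heatPotentialL2 θ t s))

theorem IsMildSolution.diffQuot_sub_eq {θ σ : ℝ} {hW : IsWhiteNoise W P} {u : ℝ → ℝ → Ω → ℝ}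
    (hu : IsMildSolution θ σ hW u) {t : ℝ} (ht : 0 < t) (a b h p x : ℝ) :
    ∀ᵐ ω ∂P, diffQuot a b h (fun y => u t y ω) (x + p) - diffQuot a b h (fun y => u t y ω) x =
      σ * hW.wienerIsometry (heatPotentialIncr θ t p ((a + b) * h) (x - b * h)) ω := by
  set T := hW.wienerIsometry
  set q := (a + b) * h with hq
  set s := x - b * h with hs
  set x1 := heatPotentialL2 θ t (s + p + q)
  set x2 := heatPotentialL2 θ t (s + p)
  set x3 := heatPotentialL2 θ t (s + q)
  set x4 := heatPotentialL2 θ t s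
  filter_upwards [hu.eq_heatPotentialL2 ht (s + p + q), hu.eq_heatPotentialL2 ht (s + p),
    hu.eq_heatPotentialL2 ht (s + q), hu.eq_heatPotentialL2 ht s,
    Lp.coeFn_smul q⁻¹ ((T x1 - T x2) - (T x3 - T x4)),
    Lp.coeFn_sub (T x1 - T x2) (T x3 - T x4), Lp.coeFn_sub (T x1) (T x2),
    Lp.coeFn_sub (T x3) (T x4)] with ω h1 h2 h3 h4 h5 h6 h7 h8
  rw [heatPotentialIncr, map_smul, map_sub, map_sub, map_sub, h5, Pi.smul_apply, h6, Pi.sub_apply,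
    h7, h8, Pi.sub_apply, Pi.sub_apply, diffQuot, diffQuot, ← hq,
    show x + p + a * h = s + p + q by rw [hs, hq]; ring,
    show x + p - b * h = s + p by rw [hs]; ring,
    show x + a * h = s + q by rw [hs, hq]; ring, h1, h2, h3, h4, smul_eq_mul]
  ring

theorem tendsto_card_mul_mesh (ℓ : ℝ) :
    Tendsto (fun N : ℕ => ((Finset.Icc 2 (N - 1)).card : ℝ) * (ℓ / N)) atTop (𝓝 ℓ) := by
  have h0 : Tendsto (fun N : ℕ => ℓ - 2 * (ℓ / N)) atTop (𝓝 (ℓ - 2 * 0)) :=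
    ((tendsto_const_div_atTop_nhds_zero_nat ℓ).const_mul 2).const_sub ℓ
  rw [mul_zero, sub_zero] at h0
  refine h0.congr' ?_
  filter_upwards [eventually_ge_atTop 2] with N hN
  have hN0 : (N : ℝ) ≠ 0 := by
    have : N ≠ 0 := by omega
    exact_mod_cast this
  rw [Nat.card_Icc, show N - 1 + 1 - 2 = N - 2 by omega, Nat.cast_sub hN]
  push_cast
  field_simp

theorem IsWhiteNoise.tendsto_integral_abs_sum_sq_incr (hW : IsWhiteNoise W P) {θ t : ℝ}
    (hθ : 0 < θ) (ht : 0 < t) {A B : ℝ} (hAB : A < B) {a b : ℝ} (ha : a ≤ 1) (hb : b ≤ 1)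
    (hab : 0 < a + b) {γ : ℝ} (hγ : 1 ≤ γ) :
    Tendsto (fun N : ℕ => ∫ ω, |∑ i ∈ Finset.Icc 2 (N - 1),
        hW.wienerIsometry (heatPotentialIncr θ t ((B - A) / N) ((a + b) * ((B - A) / (N : ℝ) ^ γ))
          (A + (B - A) / N * ((i : ℝ) - 1) - b * ((B - A) / (N : ℝ) ^ γ))) ω ^ 2 -
        (B - A) * biasFactor a b γ / θ ^ 2| ∂P) atTop (𝓝 0) := by
  have hprob := hW.gaussian.isProbabilityMeasure
  have hBA : 0 < B - A := sub_pos.2 hAB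
  -- `p + q ≤ 3 p ≤ 3 (B - A)`, because `a + b ≤ 2` and `h_N ≤ p`.
  obtain ⟨C, hC⟩ := exists_norm_second_difference_heatPotentialL2_le hθ ht (3 * (B - A))
  set K := ∫ x, x ^ 4 ∂gaussianReal 0 1 with hK
  set p : ℕ → ℝ := fun N => (B - A) / N with hp
  set v : ℕ → ℝ := fun N => (Finset.Icc 2 (N - 1)).card * p N with hv
  set κ : ℕ → ℝ := fun N => bumpRatio ((a + b) * (N : ℝ) ^ (1 - γ)) with hκ
  have hp0 : Tendsto p atTop (𝓝 0) := tendsto_const_div_atTop_nhds_zero_nat _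
  have hvl : Tendsto v atTop (𝓝 (B - A)) := tendsto_card_mul_mesh (B - A)
  have hκl : Tendsto κ atTop (𝓝 (biasFactor a b γ)) := tendsto_bumpRatio hab hγ
  -- The three error terms are the smooth perturbation, the Gaussian fluctuation and the deviation
  -- of the mean from its limit. The card of the index set is grouped with `p N` into `v N`, which
  -- stays bounded.
  have hlim : Tendsto (fun N => C * v N * (C * p N + 2 * θ⁻¹ * √(p N * κ N)) +
      θ⁻¹ ^ 2 * √(v N * p N * κ N ^ 2 * (5 * K)) +
      |θ⁻¹ ^ 2 * (v N * κ N) - (B - A) * biasFactor a b γ / θ ^ 2|) atTop (𝓝 0) := by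
    have h1 := (hvl.const_mul C).mul ((hp0.const_mul C).add
      (((hp0.mul hκl).sqrt).const_mul (2 * θ⁻¹)))
    have h2 := (((hvl.mul hp0).mul (hκl.pow 2)).mul_const (5 * K)).sqrt.const_mul (θ⁻¹ ^ 2)
    have h3 := (((hvl.mul hκl).const_mul (θ⁻¹ ^ 2)).sub_const
      ((B - A) * biasFactor a b γ / θ ^ 2)).abs
    have h4 := (h1.add h2).add h3
    rw [show θ⁻¹ ^ 2 * ((B - A) * biasFactor a b γ) - (B - A) * biasFactor a b γ / θ ^ 2 = 0 by
      field_simp; ring] at h4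
    simpa using h4
  refine squeeze_zero' (Eventually.of_forall fun N => integral_nonneg fun ω => abs_nonneg _) ?_ hlim
  filter_upwards [eventually_ge_atTop 1] with N hN
  have hN1 : (1 : ℝ) ≤ N := by exact_mod_cast hN
  have hN0 : (0 : ℝ) < N := by linarith
  have hpN : 0 < p N := div_pos hBA hN0
  have hpBA : p N ≤ B - A := div_le_self hBA.le hN1
  set h := (B - A) / (N : ℝ) ^ γ with hh
  have hh0 : 0 < h := div_pos hBA (Real.rpow_pos_of_pos hN0 _)
  have hhp : h ≤ p N := by
    refine div_le_div_of_nonneg_left hBA.le hN0 ?_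
    simpa using Real.rpow_le_rpow_of_exponent_le hN1 hγ
  have hq : 0 < (a + b) * h := mul_pos hab hh0
  have hq2 : (a + b) * h ≤ 2 * p N := mul_le_mul (by linarith) hhp hh0.le (by norm_num)
  have hratio : (a + b) * h / p N = (a + b) * (N : ℝ) ^ (1 - γ) := by
    rw [Real.rpow_sub hN0, Real.rpow_one, hh, hp]
    field_simp
  set s : ℕ → ℝ := fun i => A + p N * ((i : ℝ) - 1) - b * h with hs
  have hmain := hW.integral_abs_perturbed_sum_sq_sub_le (Finset.Icc 2 (N - 1))
    (fun i => bumpL2 hpN.le hq.le (s i)) (fun i => heatPotentialIncr θ t (p N) ((a + b) * h) (s i))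
    (p N * κ N) θ⁻¹ (C * p N) (inv_pos.2 hθ).le
    (fun i => by rw [norm_bumpL2_sq_eq_bumpRatio hpN hq, hratio])
    -- The supports start `p |i - k| ≥ 3 p` apart and have length `p + q ≤ 3 p`.
    (fun i k hik => by
      refine inner_bumpL2_eq_zero hpN.le hq.le ?_
      rw [show s i - s k = p N * ((i : ℝ) - k) by rw [hs]; ring, abs_mul, abs_of_pos hpN]
      have h3 : (3 : ℝ) ≤ |(i : ℝ) - k| := by
        rcases hik with hik | hik
        · have : (i : ℝ) + 3 ≤ k := by exact_mod_cast hik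
          exact le_abs.2 (Or.inr (by linarith))
        · have : (k : ℝ) + 3 ≤ i := by exact_mod_cast hik
          exact le_abs.2 (Or.inl (by linarith))
      nlinarith)
    (fun i => hC _ _ hpN hq (s i) (by linarith))
  obtain ⟨hint, hle⟩ := hmain
  set Y : Ω → ℝ := fun ω => ∑ i ∈ Finset.Icc 2 (N - 1),
    hW.wienerIsometry (heatPotentialIncr θ t (p N) ((a + b) * h) (s i)) ω ^ 2 with hY
  set n : ℝ := ((Finset.Icc 2 (N - 1)).card : ℝ) with hn
  set c := (B - A) * biasFactor a b γ / θ ^ 2 with hc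
  change ∫ ω, |Y ω - c| ∂P ≤ _
  have hvN : v N = n * p N := rfl
  calc ∫ ω, |Y ω - c| ∂P
      ≤ ∫ ω, (|Y ω - n * (θ⁻¹ ^ 2 * (p N * κ N))| + |θ⁻¹ ^ 2 * (v N * κ N) - c|) ∂P := by
        refine integral_mono_of_nonneg (Eventually.of_forall fun ω => abs_nonneg _)
          (hint.abs.add (integrable_const _)) (Eventually.of_forall fun ω => ?_)
        have : Y ω - c = (Y ω - n * (θ⁻¹ ^ 2 * (p N * κ N))) + (θ⁻¹ ^ 2 * (v N * κ N) - c) := by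
          rw [hvN]; ring
        simp only [this]
        exact abs_add_le _ _
    _ = ∫ ω, |Y ω - n * (θ⁻¹ ^ 2 * (p N * κ N))| ∂P + |θ⁻¹ ^ 2 * (v N * κ N) - c| := by
        rw [integral_add hint.abs (integrable_const _), integral_const, probReal_univ, one_smul]
    _ ≤ _ := by
        refine add_le_add (hle.trans (le_of_eq ?_)) le_rfl
        rw [hvN, show n * (5 * ((p N * κ N) ^ 2 * K)) = n * p N * p N * κ N ^ 2 * (5 * K) by ring]
        ring

/-- For fixed `N` only finitely many points are sampled, so the null sets of the mild solution can
be collected. -/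
theorem IsMildSolution.discreteVariation_ae_eq {θ σ : ℝ} {hW : IsWhiteNoise W P}
    {u : ℝ → ℝ → Ω → ℝ} (hu : IsMildSolution θ σ hW u) (A B a b γ : ℝ) {M : ℕ} (t : Fin M → ℝ)
    (htpos : ∀ j, 0 < t j) (N : ℕ) :
    (fun ω => ∑ j, σ ^ 2 * ∑ i ∈ Finset.Icc 2 (N - 1), hW.wienerIsometry
      (heatPotentialIncr θ (t j) ((B - A) / N) ((a + b) * ((B - A) / (N : ℝ) ^ γ))
        (A + (B - A) / N * ((i : ℝ) - 1) - b * ((B - A) / (N : ℝ) ^ γ))) ω ^ 2) =ᵐ[P]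
    fun ω => discreteVariation A B a b γ t (fun s x => u s x ω) N := by
  set h := (B - A) / (N : ℝ) ^ γ
  have hae : ∀ᵐ ω ∂P, ∀ j, ∀ i ∈ Finset.Icc 2 (N - 1),
      diffQuot a b h (fun y => u (t j) y ω) (A + (B - A) / N * ((i : ℝ) - 1) + (B - A) / N) -
        diffQuot a b h (fun y => u (t j) y ω) (A + (B - A) / N * ((i : ℝ) - 1)) =
      σ * hW.wienerIsometry (heatPotentialIncr θ (t j) ((B - A) / N) ((a + b) * h)
        (A + (B - A) / N * ((i : ℝ) - 1) - b * h)) ω := by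
    rw [ae_all_iff]
    intro j
    rw [Filter.eventually_all_finset]
    exact fun i _ => hu.diffQuot_sub_eq (htpos j) a b h _ _
  filter_upwards [hae] with ω hω
  rw [discreteVariation]
  refine Finset.sum_congr rfl fun j _ => ?_
  rw [Finset.mul_sum]
  refine Finset.sum_congr rfl fun i hi => ?_
  have hi1 : 1 ≤ i := by
    have := (Finset.mem_Icc.1 hi).1
    omega
  have h1 : gridPoint A B N i = A + (B - A) / N * ((i : ℝ) - 1) + (B - A) / N := by
    rw [gridPoint]; ring
  have h2 : gridPoint A B N (i - 1) = A + (B - A) / N * ((i : ℝ) - 1) := by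
    rw [gridPoint, Nat.cast_sub hi1]; push_cast; ring
  rw [h1, h2, hω j i hi, mul_pow]

/-- Nothing about the dependence between different times is needed: the `L¹` errors add up over the
`M` times. -/
theorem IsMildSolution.tendstoInMeasure_discreteVariation {θ σ : ℝ} {hW : IsWhiteNoise W P}
    {u : ℝ → ℝ → Ω → ℝ} (hu : IsMildSolution θ σ hW u) (hθ : 0 < θ) {A B : ℝ} (hAB : A < B)
    {a b : ℝ} (ha : a ≤ 1) (hb : b ≤ 1) (hab : 0 < a + b) {γ : ℝ} (hγ : 1 ≤ γ) {M : ℕ}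
    (t : Fin M → ℝ) (htpos : ∀ j, 0 < t j) :
    TendstoInMeasure P
      (fun (N : ℕ) ω => discreteVariation A B a b γ t (fun s x => u s x ω) N) atTop
      fun _ => M * (σ ^ 2 * ((B - A) * biasFactor a b γ / θ ^ 2)) := by
  have hprob := hW.gaussian.isProbabilityMeasure
  refine TendstoInMeasure.congr_left
    (fun N => hu.discreteVariation_ae_eq A B a b γ t htpos N) ?_
  set c := (B - A) * biasFactor a b γ / θ ^ 2 with hc
  set Y : Fin M → ℕ → Ω → ℝ := fun j N ω => ∑ i ∈ Finset.Icc 2 (N - 1), hW.wienerIsometry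
      (heatPotentialIncr θ (t j) ((B - A) / N) ((a + b) * ((B - A) / (N : ℝ) ^ γ))
        (A + (B - A) / N * ((i : ℝ) - 1) - b * ((B - A) / (N : ℝ) ^ γ))) ω ^ 2 with hY
  have hint : ∀ j N, Integrable (fun ω => Y j N ω - c) P := fun j N =>
    (integrable_finsetSum _ fun i _ => (Lp.memLp _).integrable_sq).sub (integrable_const _)
  have hlim : ∀ j, Tendsto (fun N => ∫ ω, |Y j N ω - c| ∂P) atTop (𝓝 0) := fun j =>
    hW.tendsto_integral_abs_sum_sq_incr hθ (htpos j) hAB ha hb hab hγ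
  have hsum : ∀ N ω, ∑ j, σ ^ 2 * Y j N ω - M * (σ ^ 2 * c) =
      ∑ j, σ ^ 2 * (Y j N ω - c) := by
    intro N ω
    simp only [mul_sub, Finset.sum_sub_distrib, Finset.sum_const, Finset.card_univ,
      Fintype.card_fin, nsmul_eq_mul]
  refine tendstoInMeasure_of_integral_abs (fun N => ?_) ?_
  · refine Integrable.congr ?_ (Eventually.of_forall fun ω => (hsum N ω).symm)
    exact integrable_finsetSum _ fun j _ => (hint j N).const_mul _
  · have h0 : Tendsto (fun N => ∑ j, σ ^ 2 * ∫ ω, |Y j N ω - c| ∂P) atTop (𝓝 0) := by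
      simpa using tendsto_finsetSum Finset.univ fun j _ => (hlim j).const_mul (σ ^ 2)
    refine squeeze_zero (fun N => integral_nonneg fun ω => abs_nonneg _) (fun N => ?_) h0
    have hi : ∀ j ∈ Finset.univ, Integrable (fun ω => σ ^ 2 * |Y j N ω - c|) P := fun j _ =>
      (hint j N).abs.const_mul _
    simp only [← integral_const_mul]
    rw [← integral_finsetSum _ hi]
    refine integral_mono_of_nonneg (Eventually.of_forall fun ω => abs_nonneg _)
      (integrable_finsetSum _ hi) (Eventually.of_forall fun ω => ?_)
    refine (congrArg abs (hsum N ω)).trans_le ?_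
    refine (Finset.abs_sum_le_sum_abs _ _).trans (le_of_eq ?_)
    refine Finset.sum_congr rfl fun j _ => ?_
    rw [abs_mul, abs_of_nonneg (sq_nonneg σ)]

end SpaceNoiseHeat

theorem corollary3p7 {Ω : Type*} [MeasurableSpace Ω] (P : Measure Ω) [IsProbabilityMeasure P]
    (W : Lp ℝ 2 (volume : Measure ℝ) → Ω → ℝ) (hW : SpaceNoiseHeat.IsWhiteNoise W P)
    (θ σ : ℝ) (hθ : 0 < θ)
    (u : ℝ → ℝ → Ω → ℝ) (hu : SpaceNoiseHeat.IsMildSolution θ σ hW u)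
    (A B : ℝ) (hAB : A < B)
    (a b : ℝ) (ha : a ∈ Set.Icc (0 : ℝ) 1) (hb : b ∈ Set.Icc (0 : ℝ) 1) (hab : 0 < a + b)
    (γ : ℝ) (hγ : 1 ≤ γ)
    (M : ℕ) (hM : 1 ≤ M) (t : Fin M → ℝ) (ht : StrictMono t) (htpos : ∀ j, 0 < t j) :
    (σ ≠ 0 →
      TendstoInMeasure P
        (fun (N : ℕ) (ω : Ω) => SpaceNoiseHeat.biasFactor a b γ *
          SpaceNoiseHeat.thetaSqEstimator σ A B a b γ t (fun s x => u s x ω) N)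
        atTop (fun _ => θ ^ 2)) ∧
    TendstoInMeasure P
      (fun (N : ℕ) (ω : Ω) => 1 / SpaceNoiseHeat.biasFactor a b γ *
        SpaceNoiseHeat.sigmaSqEstimator θ A B a b γ t (fun s x => u s x ω) N)
      atTop (fun _ => σ ^ 2) := by 
  have hμ := SpaceNoiseHeat.biasFactor_pos (γ := γ) hab
  have hBA : 0 < B - A := sub_pos.2 hAB
  have hM0 : (0 : ℝ) < M := by exact_mod_cast hM
  have hS := hu.tendstoInMeasure_discreteVariation hθ hAB ha.2 hb.2 hab hγ t htpos
  refine ⟨fun hσ => ?_, ?_⟩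
  · have hφ : ContinuousAt
        (fun S => SpaceNoiseHeat.biasFactor a b γ * (σ ^ 2 * M * (B - A) / S))
        (M * (σ ^ 2 * ((B - A) * SpaceNoiseHeat.biasFactor a b γ / θ ^ 2))) := by
      -- The limit of the discrete variation is nonzero because `σ ≠ 0`, so division by it is
      -- continuous there.
      have : M * (σ ^ 2 * ((B - A) * SpaceNoiseHeat.biasFactor a b γ / θ ^ 2)) ≠ 0 := by
        positivity
      fun_prop (disch := assumption)
    have h := SpaceNoiseHeat.tendstoInMeasure_comp_continuousAt hS hφ
    have hval : SpaceNoiseHeat.biasFactor a b γ * (σ ^ 2 * M * (B - A) /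
        (M * (σ ^ 2 * ((B - A) * SpaceNoiseHeat.biasFactor a b γ / θ ^ 2)))) = θ ^ 2 := by
      field_simp
    simp only [hval] at h
    exact h
  · have hφ : ContinuousAt
        (fun S => 1 / SpaceNoiseHeat.biasFactor a b γ * (θ ^ 2 * S / (M * (B - A))))
        (M * (σ ^ 2 * ((B - A) * SpaceNoiseHeat.biasFactor a b γ / θ ^ 2))) := by
      fun_prop
    have h := SpaceNoiseHeat.tendstoInMeasure_comp_continuousAt hS hφ
    have hval : 1 / SpaceNoiseHeat.biasFactor a b γ * (θ ^ 2 *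
        (M * (σ ^ 2 * ((B - A) * SpaceNoiseHeat.biasFactor a b γ / θ ^ 2))) / (M * (B - A))) =
        σ ^ 2 := by
      field_simp
    simp only [hval] at h
    exact h
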